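/- Let $n\ge 1$ and let $\beta$ be a $2n$-strand spherical braid: an isotopy $F$ of $S^2$ with $F_0=\mathrm{id}$ and $F_1$ a diffeomorphism mapping to itself a set of $2n$ points $p_i$, $i\in\mathbb{Z}/2n$, placed symmetrically in cyclic order on an equator; its strings are the arcs $\{(F_t(p_i),t) : 0\le t\le 1\}$ in $S^2\times[0,1]$. Let $f_\beta$ be the permutation of $\mathbb{Z}/2n$ with $F_1(p_i)=p_{f_\beta(i)}$. View $\mathbb{R}P^3$ as $M\cup (S^2\times[0,1])\cup B$, where the boundary of the mapping cylinder $M$ of the double cover $S^2\to\mathbb{R}P^2$ is glued to $S^2\times\{0\}$ and the boundary of the 3-ball $B$ is glued to $S^2\times\{1\}$. The projective plat closure of $\beta$ is the union of the strings of $\beta$, the $n$ arcs in $M$ formed by the fibres of $M$ through the points $p_i$ (joining $p_i$ to $p_{i+n}$), and the $n$ straight arcs in $B$ joining $p_i$ to $p_{i+1}$ for $i$ odd. Let $g(i)=i+1$ for odd classes $i$ and $g(i)=i-1$ for even classes $i$, let $\tau=f_\beta^{-1}gf_\beta$, and let $H=\{0,n\}\subset\mathbb{Z}/2n$. A residual permutation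 of $\beta$ is a permutation $h_\beta$ of $(\mathbb{Z}/2n)/H$ for which there is a choice of representatives $r(x)\in x$ of the cosets such that, for every coset $x$, $$h_\beta(x)=[\tau(r(x))]\quad\text{and}\quad r(h_\beta(x))=\tau(r(x))+n .$$ Then $\beta$ has a residual permutation, and for every residual permutation $h_\beta$ of $\beta$ the number of connected components of the projective plat closure of $\beta$ equals the number of disjoint cycles of $h_\beta$, fixed points counted as cycles of length one. -/

import Mathlib

open scoped Manifold ContDiff unitInterval

noncomputable section

namespace ProjectivePlat

/-- The Euclidean space containing the 3-ball. -/
abbrev E3 : Type := EuclideanSpace ℝ (Fin 3)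

/-- The 2-sphere. -/
abbrev S2 : Type := Metric.sphere (0 : E3) 1

/-- The closed 3-ball `B`, whose boundary is the 2-sphere. -/
abbrev Ball3 : Type := Metric.closedBall (0 : E3) 1

/-- The inclusion of the 2-sphere as the boundary of the 3-ball. -/
def sphereToBall (x : S2) : Ball3 := ⟨x.1, Metric.sphere_subset_closedBall x.2⟩

/-! ### Special points on the equator -/

/-- The special points `p i`, `i ∈ ℤ/k`: the vertices of a regular `k`-gon on the equatorial circle,
indexed cyclically, like the numbers on a clock (clockwise when seen from below). For `k = 2n` the
points `p i` and `p (i + n)` are diametrically opposite. -/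
def point {k : ℕ} [NeZero k] (i : ZMod k) : S2 :=
  ⟨!₂[(ZMod.toCircle i : ℂ).re, (ZMod.toCircle i : ℂ).im, 0], by
    have h := Circle.normSq_coe (ZMod.toCircle i)
    rw [Complex.normSq_apply] at h
    simp [EuclideanSpace.norm_eq, Fin.sum_univ_three]
    nlinarith⟩

theorem point_injective {k : ℕ} [NeZero k] : Function.Injective (point (k := k)) := by
  intro i j h
  have h' : (point i : S2).1 = (point j).1 := congrArg Subtype.val h
  have h0 := congrArg (fun v : E3 => v 0) h'
  have h1 := congrArg (fun v : E3 => v 1) h'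
  simp [point] at h0 h1
  exact ZMod.injective_toCircle (Circle.ext (Complex.ext h0 h1))

/-! ### Spherical braids -/

/-- A (geometric) `k`-strand braid of the 2-sphere, given by an isotopy `F` of the sphere
that starts at the identity and ends at a diffeomorphism mapping the set of special points to
itself. Smooth isotopies are a special case. -/
structure SphericalBraid (k : ℕ) [NeZero k] where
  /-- The homeomorphism `F_t` of the sphere at time `t`. -/
  F : I → S2 ≃ₜ S2
  continuous_F : Continuous fun q : S2 × I => F q.2 q.1
  F_zero : ∀ x, F 0 x = x
  F_one_diffeo : ∃ φ : S2 ≃ₘ^∞⟮𝓡 2, 𝓡 2⟯ S2, ∀ x, φ x = F 1 x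
  F_one_maps : Set.MapsTo (F 1) (Set.range (point (k := k))) (Set.range (point (k := k)))

namespace SphericalBraid

/-- The strings of the braid, as a subset of `S² × I`: the image of `X × I`, where `X` is the set of
special points, under `(q, t) ↦ (F_t q, t)`. -/
def strings {k : ℕ} [NeZero k] (β : SphericalBraid k) : Set (S2 × I) :=
  (fun q : S2 × I => (β.F q.2 q.1, q.2)) '' (Set.range (point (k := k)) ×ˢ Set.univ)

theorem exists_end {k : ℕ} [NeZero k] (β : SphericalBraid k) (i : ZMod k) :
    ∃ j : ZMod k, point j = β.F 1 (point i) :=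
  β.F_one_maps ⟨i, rfl⟩

theorem end_bijective {k : ℕ} [NeZero k] (β : SphericalBraid k) :
    Function.Bijective fun i => (β.exists_end i).choose := by
  refine Finite.injective_iff_bijective.mp fun i j h => ?_
  have hi := (β.exists_end i).choose_spec
  have hj := (β.exists_end j).choose_spec
  have h' : (β.exists_end i).choose = (β.exists_end j).choose := h
  rw [h', hj] at hi
  exact (point_injective ((β.F 1).injective hi)).symm

/-- The permutation `f_β` of `ℤ/k`: the string that starts at `(p i, 0)` ends at
`(p (f_β i), 1)`. -/
def perm {k : ℕ} [NeZero k] (β : SphericalBraid k) : Equiv.Perm (ZMod k) :=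
  Equiv.ofBijective _ β.end_bijective

theorem point_perm {k : ℕ} [NeZero k] (β : SphericalBraid k) (i : ZMod k) :
    point (β.perm i) = β.F 1 (point i) :=
  (β.exists_end i).choose_spec

end SphericalBraid

/-! ### The splitting of real projective 3-space -/

/-- The antipodal equivalence relation on the 2-sphere. -/
def antipodal : Setoid S2 where
  r x y := y = x ∨ y = -x
  iseqv :=
    { refl := fun _ => Or.inl rfl
      symm := by
        rintro x y (h | h)
        · exact Or.inl h.symm
        · exact Or.inr (by rw [h, neg_neg])
      trans := by
        rintro x y z (h | h) (h' | h')
        · exact Or.inl (by rw [h', h])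
        · exact Or.inr (by rw [h', h])
        · exact Or.inr (by rw [h', h])
        · exact Or.inl (by rw [h', h, neg_neg]) }

/-- The real projective plane. -/
abbrev RP2 : Type := Quotient antipodal

/-- The canonical two-sheeted covering map. -/
def cover (x : S2) : RP2 := Quotient.mk antipodal x

/-- The identification `(x, 1) ~ f x` that defines the mapping cylinder of `f`. -/
inductive CylinderRel {X Y : Type} (f : X → Y) : (X × I) ⊕ Y → (X × I) ⊕ Y → Prop
  | glue (x : X) : CylinderRel f (Sum.inl (x, 1)) (Sum.inr (f x))

/-- The mapping cylinder of `f`, with the quotient topology. -/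
abbrev MappingCylinder {X Y : Type} (f : X → Y) : Type := Quot (CylinderRel f)

/-- The mapping cylinder `M` of the covering map from the sphere to the projective plane;
its boundary is the free end `S² × {0}` of the cylinder. -/
abbrev M : Type := MappingCylinder cover

/-- The image in `M` of the point `(x, t)` of the cylinder `S² × I`. -/
def cylPoint (q : S2 × I) : M := Quot.mk _ (Sum.inl q)

/-- The boundary of `M` is glued to `S² × {0}`, and the boundary of the ball `B` is glued to
`S² × {1}`. -/
inductive GlueRel : M ⊕ (S2 × I) ⊕ Ball3 → M ⊕ (S2 × I) ⊕ Ball3 → Prop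
  | outer (x : S2) : GlueRel (Sum.inl (cylPoint (x, 0))) (Sum.inr (Sum.inl (x, 0)))
  | inner (x : S2) : GlueRel (Sum.inr (Sum.inl (x, 1))) (Sum.inr (Sum.inr (sphereToBall x)))

/-- Real projective 3-space, as the union of `M`, the strip `S² × I` and the ball `B`, glued along
their boundaries, with the quotient topology. -/
abbrev RP3 : Type := Quot GlueRel

/-- The map of `M` to the glued space. -/
def ofM (x : M) : RP3 := Quot.mk _ (Sum.inl x)

/-- The map of the strip `S² × I` to the glued space. -/
def ofStrip (x : S2 × I) : RP3 := Quot.mk _ (Sum.inr (Sum.inl x))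

/-- The map of the ball to the glued space. -/
def ofBall (x : Ball3) : RP3 := Quot.mk _ (Sum.inr (Sum.inr x))

/-! ### The permutation of the internal tangle -/

theorem odd_val_add_one {n : ℕ} [NeZero n] (i : ZMod (2 * n)) :
    Odd (i + 1).val ↔ ¬ Odd i.val := by
  have hn : 0 < n := Nat.pos_of_neZero n
  have h1 : (1 : ZMod (2 * n)).val = 1 := by
    have : Fact (1 < 2 * n) := ⟨by omega⟩
    exact ZMod.val_one (2 * n)
  have h2 : (i + 1).val % 2 = (i.val + 1) % 2 := by
    rw [ZMod.val_add, h1, Nat.mod_mul_right_mod]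
  rw [Nat.odd_iff, Nat.odd_iff]
  omega

/-- `g i = i + 1` if `i` is an odd class, and `g i = i - 1` if `i` is an even class. -/
def gFun {n : ℕ} [NeZero n] (i : ZMod (2 * n)) : ZMod (2 * n) :=
  if Odd i.val then i + 1 else i - 1

theorem gFun_involutive {n : ℕ} [NeZero n] : Function.Involutive (gFun (n := n)) := by
  intro i
  have h := odd_val_add_one (i - 1)
  rw [sub_add_cancel] at h
  unfold gFun
  by_cases hi : Odd i.val
  · simp [hi, odd_val_add_one]
  · have : Odd (i - 1).val := by tauto
    simp [hi, this]

/-- The permutation `g` of `ℤ/2n`. -/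
def g (n : ℕ) [NeZero n] : Equiv.Perm (ZMod (2 * n)) := gFun_involutive.toPerm

/-! ### Tangles and the projective plat closure -/

/-- The internal tangle in the ball `B`: it consists of `n` disjoint straight arcs in the flat disk
bounded by the equator, one from `p i` to `p (i + 1) = p (g i)` for each odd class `i`. -/
def internalTangle (n : ℕ) [NeZero n] : Set Ball3 :=
  {x | ∃ i : ZMod (2 * n), Odd i.val ∧ x.1 ∈ segment ℝ (point i).1 (point (i + 1)).1}

/-- The residual tangle in `M`: it consists of `n` disjoint arcs in the flat Möbius band in `M` lying
over the equator. Each is the full fibre of `M` over a point of the projective plane; as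
`(p i, 1)` and `(p (i + n), 1)` are identified in `M`, it joins `(p i, 0)` to `(p (i + n), 0)`, and it
crosses the core of the band once. -/
def residualTangle (n : ℕ) [NeZero n] : Set M :=
  {x | ∃ (i : ZMod (2 * n)) (t : I), x = cylPoint (point i, t)}

/-- The projective plat closure of a `2n`-strand spherical braid. -/
def platClosure {n : ℕ} [NeZero n] (β : SphericalBraid (2 * n)) : Set RP3 :=
  ofM '' residualTangle n ∪ ofStrip '' β.strings ∪ ofBall '' internalTangle n

/-! ### Residual permutations -/

/-- The quotient of `ℤ/2n` by the subgroup of order two generated by the class of `n`. -/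
abbrev Coset (n : ℕ) : Type :=
  ZMod (2 * n) ⧸ AddSubgroup.zmultiples (n : ZMod (2 * n))

/-- The permutation `f_β⁻¹ g f_β` of `ℤ/2n` (first `f_β` is applied, then `g`, then `f_β⁻¹`). -/
def tau {n : ℕ} [NeZero n] (β : SphericalBraid (2 * n)) : Equiv.Perm (ZMod (2 * n)) :=
  β.perm⁻¹ * g n * β.perm

/-- `h` is a residual permutation of `β`: a permutation of the cosets that is induced by
`f_β⁻¹ g f_β` through a choice `r` of representatives that is coherent along the cycles of `h`.
Starting from the representative `j = r x` of `x`, the next coset `h x` is that of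
`f_β⁻¹ g f_β j`, and its representative is the other element `f_β⁻¹ g f_β j + n`, where one arrives
after passing through the residual arc. -/
def IsResidualPerm {n : ℕ} [NeZero n] (β : SphericalBraid (2 * n))
    (h : Equiv.Perm (Coset n)) : Prop :=
  ∃ r : Coset n → ZMod (2 * n),
    (∀ x, (QuotientAddGroup.mk (r x) : Coset n) = x) ∧
    (∀ x, h x = QuotientAddGroup.mk (tau β (r x))) ∧
    (∀ x, r (h x) = tau β (r x) + n)

/-- The number of disjoint cycles of a permutation, fixed points counted as cycles of length
one. -/
def numCycles {α : Type} (h : Equiv.Perm α) : ℕ :=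
  Nat.card (Quotient (Equiv.Perm.SameCycle.setoid h))

/-- The number of connected components of a subset of a topological space. -/
def numComponents {X : Type} [TopologicalSpace X] (L : Set X) : ℕ :=
  Nat.card (ConnectedComponents L)

end ProjectivePlat

end

noncomputable section

namespace ProjectivePlat

/-! ### Products of two fixed-point-free involutions. -/

section Dihedral

variable {α : Type*}

/-! Write `τ` for `tau β`. The closure is a union of arcs indexed by `i ∈ ℤ/2n`, where residual arcs
link `i` with `i + n` and chords of the ball link `i` with `τ i`. Its components are therefore the
orbits of the dihedral group generated by two fixed-point-free involutions, `s : i ↦ i + n` and `τ`.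

Each orbit splits into two cycles of `s * τ`, exchanged by `s`. Choosing one cycle per orbit orients
the components; its elements represent the cosets, and `s * τ` induces a residual permutation
(`exists_isResidualPerm`). Conversely, the cycles of any residual permutation are these orbits
(`IsResidualPerm.sameCycle_tau`, `IsResidualPerm.eq_of_sameCycle`).

On the topological side, linked indices lie in one component because arcs are connected
(`component_add_half`, `component_tau`). Different orbits are separated because a set of indices
stable under both involutions, and its complement, give disjoint closed sets covering the closure
(`IsSaturated.mem_of_component_eq`). -/

theorem conj_mul_zpow {s t : Equiv.Perm α} (hs : Function.Involutive s)
    (ht : Function.Involutive t) (m : ℤ) (i : α) :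
    ((s * t) ^ m) (s (((s * t) ^ m) i)) = s i := by
  have hs1 : s * s = 1 := Equiv.ext hs
  have ht1 : t * t = 1 := Equiv.ext ht
  have hinv : (s * t)⁻¹ = t * s := by
    rw [mul_inv_rev, inv_eq_of_mul_eq_one_left hs1, inv_eq_of_mul_eq_one_left ht1]
  -- The dihedral relation: `s` conjugates `s * t` to its inverse.
  have h1 : SemiconjBy s (s * t) (s * t)⁻¹ := by
    rw [hinv]
    change s * (s * t) = t * s * s
    rw [← mul_assoc, mul_assoc t, hs1, one_mul, mul_one]
  have h2 : s * (s * t) ^ m = ((s * t)⁻¹) ^ m * s := h1.zpow_right m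
  have h3 : (s * t) ^ m * (s * (s * t) ^ m) = s := by
    rw [h2, ← mul_assoc, inv_zpow, mul_inv_cancel, one_mul]
  exact congrArg (fun e : Equiv.Perm α => e i) h3

/-- If two involutions have no fixed points, then no cycle of their product contains a point
together with its image under one of them. -/
theorem not_sameCycle_mul_involutive {s t : Equiv.Perm α} (hs : Function.Involutive s)
    (ht : Function.Involutive t) (fs : ∀ i, s i ≠ i) (ft : ∀ i, t i ≠ i) (i : α) :
    ¬ (s * t).SameCycle i (s i) := by
  rintro ⟨m, hm⟩
  -- By `conj_mul_zpow`, `(s * t) ^ a i` is a fixed point of `s` if `m = 2a`, and of `t` if `m = 2a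
  -- + 1`.
  obtain ⟨a, rfl | rfl⟩ := m.even_or_odd'
  · have h := conj_mul_zpow hs ht a i
    rw [← hm, two_mul, zpow_add, Equiv.Perm.mul_apply] at h
    exact fs _ (((s * t) ^ a).injective h)
  · have h := conj_mul_zpow hs ht a i
    rw [← hm, show 2 * a + 1 = a + (1 + a) by ring, zpow_add, zpow_one_add, Equiv.Perm.mul_apply,
      Equiv.Perm.mul_apply, Equiv.Perm.mul_apply] at h
    exact ft _ (s.injective (((s * t) ^ a).injective h)).symm

/-- A transversal of a fixed-point free involution `s` that is invariant under `s * t`. -/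
theorem exists_invariant_transversal {s t : Equiv.Perm α} (hs : Function.Involutive s)
    (ht : Function.Involutive t) (fs : ∀ i, s i ≠ i) (ft : ∀ i, t i ≠ i) :
    ∃ R : Set α, (∀ i ∈ R, s (t i) ∈ R) ∧ ∀ i, s i ∈ R ↔ i ∉ R := by
  let key : α → Quotient (Equiv.Perm.SameCycle.setoid (s * t)) := Quotient.mk _
  -- An arbitrary linear order on the cycles; since `s` exchanges them in pairs, `R` can keep the
  -- smaller of each pair.
  obtain ⟨_, -⟩ := exists_wellFoundedLT (Quotient (Equiv.Perm.SameCycle.setoid (s * t)))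
  have key_eq {i j : α} : key i = key j ↔ (s * t).SameCycle i j := Quotient.eq
  refine ⟨{i | key i < key (s i)}, fun i hi => ?_, fun i => ?_⟩
  · have h1 : key (s (t i)) = key i :=
      key_eq.2 (Equiv.Perm.sameCycle_apply_left.2 (Equiv.Perm.SameCycle.refl _ i))
    have h2 : key (s (s (t i))) = key (s i) := by
      refine key_eq.2 ⟨1, ?_⟩
      simp [hs (t i), ht i]
    simpa only [Set.mem_ofPred_eq, h1, h2] using hi
  · have h : key i ≠ key (s i) := fun h =>
      not_sameCycle_mul_involutive hs ht fs ft i (key_eq.1 h)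
    simp only [Set.mem_ofPred_eq, hs i, not_lt]
    exact ⟨le_of_lt, fun h' => lt_of_le_of_ne h' h.symm⟩

end Dihedral

/-! ### Residual permutations: existence and cycles. -/

section Combinatorics

theorem natCast_add_self {n : ℕ} : (n : ZMod (2 * n)) + n = 0 := by
  have := ZMod.natCast_self (2 * n)
  push_cast at this
  rw [← two_mul, this]

variable {n : ℕ} [NeZero n]

theorem natCast_half_ne_zero : (n : ZMod (2 * n)) ≠ 0 := by
  have hn : 0 < n := Nat.pos_of_neZero n
  intro h
  rw [ZMod.natCast_eq_zero_iff] at h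
  have := Nat.le_of_dvd hn h
  omega

theorem coset_mk_eq_iff {n : ℕ} {i j : ZMod (2 * n)} :
    (QuotientAddGroup.mk i : Coset n) = QuotientAddGroup.mk j ↔ j = i ∨ j = i + n := by
  rw [QuotientAddGroup.eq, AddSubgroup.mem_zmultiples_iff]
  have h2 (a : ℤ) : (2 * a) • (n : ZMod (2 * n)) = 0 := by
    rw [mul_comm 2 a, mul_smul, two_zsmul, natCast_add_self, smul_zero]
  constructor
  · rintro ⟨k, hk⟩
    obtain ⟨a, rfl | rfl⟩ := k.even_or_odd'
    · left
      rw [h2] at hk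
      linear_combination -hk
    · right
      rw [add_smul, h2, one_zsmul] at hk
      linear_combination -hk
  · rintro (rfl | rfl)
    · exact ⟨0, by simp⟩
    · exact ⟨1, by simp⟩

theorem coset_mk_add {n : ℕ} (i : ZMod (2 * n)) :
    (QuotientAddGroup.mk (i + n) : Coset n) = QuotientAddGroup.mk i :=
  (coset_mk_eq_iff.2 (Or.inr rfl)).symm

theorem g_involutive : Function.Involutive (g n) := gFun_involutive

theorem g_ne_self (i : ZMod (2 * n)) : g n i ≠ i := by
  have hn : 0 < n := Nat.pos_of_neZero n
  have : Fact (1 < 2 * n) := ⟨by omega⟩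
  change gFun i ≠ i
  unfold gFun
  split_ifs <;> simp

variable (β : SphericalBraid (2 * n))

theorem perm_tau (i : ZMod (2 * n)) : β.perm (tau β i) = g n (β.perm i) := by
  simp [tau]

theorem tau_involutive : Function.Involutive (tau β) := by
  intro i
  apply β.perm.injective
  rw [perm_tau, perm_tau, g_involutive]

theorem tau_ne_self (i : ZMod (2 * n)) : tau β i ≠ i := by
  intro h
  have := perm_tau β i
  rw [h] at this
  exact g_ne_self _ this.symm

/-- Coherence of `r` says that its range, a transversal of the cosets, is stable under `i ↦ τ i +
n`, a product of two fixed-point-free involutions. -/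
theorem exists_isResidualPerm : ∃ h : Equiv.Perm (Coset n), IsResidualPerm β h := by
  have hs : Function.Involutive (Equiv.addRight (n : ZMod (2 * n))) := fun i => by
    simp [add_assoc, natCast_add_self]
  obtain ⟨R, hR, hR'⟩ := exists_invariant_transversal hs (tau_involutive β)
    (fun i => by simp [natCast_half_ne_zero]) (tau_ne_self β)
  simp only [Equiv.coe_addRight] at hR hR'
  have hex (x : Coset n) : ∃ i ∈ R, (QuotientAddGroup.mk i : Coset n) = x := by
    obtain ⟨i, rfl⟩ := QuotientAddGroup.mk_surjective x
    by_cases hi : i ∈ R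
    · exact ⟨i, hi, rfl⟩
    · exact ⟨i + n, (hR' i).2 hi, coset_mk_add i⟩
  choose r hrR hr using hex
  have huniq {i j : ZMod (2 * n)} (hi : i ∈ R) (hj : j ∈ R)
      (h : (QuotientAddGroup.mk i : Coset n) = QuotientAddGroup.mk j) : i = j := by
    rcases coset_mk_eq_iff.1 h with rfl | rfl
    · rfl
    · exact absurd hi ((hR' i).1 hj)
  have hrep (x : Coset n) : r (QuotientAddGroup.mk (tau β (r x))) = tau β (r x) + n :=
    huniq (hrR _) (hR _ (hrR x)) (by rw [hr, coset_mk_add])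
  have hinj : Function.Injective fun x : Coset n =>
      (QuotientAddGroup.mk (tau β (r x)) : Coset n) := by
    intro x y hxy
    have h := congrArg r hxy
    simp only [hrep] at h
    rw [← hr x, ← hr y, (tau β).injective (add_right_cancel h)]
  have : Finite (Coset n) := Quotient.finite _
  exact ⟨Equiv.ofBijective _ (Finite.injective_iff_bijective.1 hinj), r, hr, fun _ => rfl, hrep⟩

variable {β}

/-- The permutation `f_β⁻¹ g f_β` preserves the cycles of a residual permutation. -/
theorem IsResidualPerm.sameCycle_tau {h : Equiv.Perm (Coset n)} (hh : IsResidualPerm β h)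
    (i : ZMod (2 * n)) :
    h.SameCycle (QuotientAddGroup.mk (tau β i)) (QuotientAddGroup.mk i) := by
  obtain ⟨r, hr, hr1, hr2⟩ := hh
  rcases coset_mk_eq_iff.1 (hr (QuotientAddGroup.mk i)).symm with hi | hi
  · have := hr1 (QuotientAddGroup.mk i)
    rw [hi] at this
    exact (Equiv.Perm.SameCycle.symm ⟨1, by rw [zpow_one, this]⟩)
  -- Here `i + n` is the chosen representative, so `τ i` represents the preceding coset in the
  -- cycle.
  · set y := h.symm (QuotientAddGroup.mk i) with hy
    have hy' : h y = QuotientAddGroup.mk i := h.apply_symm_apply _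
    have h1 := hr2 y
    rw [hy', hi] at h1
    have h2 : tau β i = r y := by rw [add_right_cancel h1, tau_involutive]
    exact ⟨1, by rw [zpow_one, h2, hr, hy']⟩

/-- A function on the special points that is constant along the residual arcs and along the arcs
of the braid closed up by the internal tangle is constant on the cycles of a residual
permutation. -/
theorem IsResidualPerm.eq_of_sameCycle {h : Equiv.Perm (Coset n)} (hh : IsResidualPerm β h)
    {γ : Type*} {c : ZMod (2 * n) → γ} (hn : ∀ i, c (i + n) = c i) (hτ : ∀ i, c (tau β i) = c i)
    {i j : ZMod (2 * n)}
    (hij : h.SameCycle (QuotientAddGroup.mk i) (QuotientAddGroup.mk j)) : c i = c j := by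
  obtain ⟨r, hr, hr1, hr2⟩ := hh
  have hmk {i j : ZMod (2 * n)} (e : (QuotientAddGroup.mk i : Coset n) = QuotientAddGroup.mk j) :
      c i = c j := by
    rcases coset_mk_eq_iff.1 e with rfl | rfl
    · rfl
    · exact (hn i).symm
  have step (x : Coset n) : c (r (h x)) = c (r x) := by rw [hr2, hn, hτ]
  have hpow (m : ℤ) (x : Coset n) : c (r ((h ^ m) x)) = c (r x) := by
    induction m with
    | zero => rfl
    | succ m ih => rw [add_comm, zpow_add, zpow_one, Equiv.Perm.mul_apply, step, ih]
    | pred m ih =>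
      rw [← ih, ← step ((h ^ (-(m : ℤ) - 1)) x), ← Equiv.Perm.mul_apply, ← zpow_one_add]
      congr 4
      ring
  obtain ⟨m, hm⟩ := hij
  rw [← hmk (hr (QuotientAddGroup.mk i)), ← hmk (hr (QuotientAddGroup.mk j)), ← hm, hpow]

end Combinatorics

/-! ### Geometry of the special points and chords. -/

section Points

theorem point_zero {k : ℕ} [NeZero k] (i : ZMod k) :
    (point i).1 0 = Real.cos (2 * Real.pi * i.val / k) := by
  simp only [point, ZMod.toCircle_apply]
  rw [← Complex.exp_ofReal_mul_I_re]
  simp only [Matrix.cons_val_zero]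
  congr 2
  push_cast
  ring

theorem point_one {k : ℕ} [NeZero k] (i : ZMod k) :
    (point i).1 1 = Real.sin (2 * Real.pi * i.val / k) := by
  simp only [point, ZMod.toCircle_apply]
  rw [← Complex.exp_ofReal_mul_I_im]
  simp only [Matrix.cons_val_one, Matrix.cons_val_zero]
  congr 2
  push_cast
  ring

variable {n : ℕ} [NeZero n]

theorem point_add_half (i : ZMod (2 * n)) : point (i + (n : ZMod (2 * n))) = -point i := by
  have hn : (n : ℂ) ≠ 0 := Nat.cast_ne_zero.2 (NeZero.ne n)
  have h : (ZMod.toCircle (n : ZMod (2 * n)) : ℂ) = -1 := by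
    rw [ZMod.toCircle_natCast, ← Complex.exp_pi_mul_I]
    congr 1
    push_cast
    field_simp
  apply Subtype.ext
  ext k
  fin_cases k <;> simp [point, AddChar.map_add_eq_mul, h]

theorem cover_point_eq_iff {x : S2} {i : ZMod (2 * n)} :
    cover x = cover (point i) ↔ x = point i ∨ x = point (i + (n : ZMod (2 * n))) := by
  rw [point_add_half]
  constructor
  · intro h
    rcases (Quotient.exact h : point i = x ∨ point i = -x) with h | h
    · exact Or.inl h.symm
    · exact Or.inr (by rw [h, neg_neg])
  · rintro (h | h)
    · rw [h]
    · exact Quotient.sound (Or.inr (by rw [h, neg_neg]))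

/-- The linear functional of the plane of the equator whose maximum on the special points is
attained exactly at `point j` and `point (j + 1)`. -/
def height (j : ZMod (2 * n)) : E3 →ₗ[ℝ] ℝ :=
  Real.cos (Real.pi * (j.val + 1 / 2) / n) •
      (EuclideanSpace.proj (0 : Fin 3) : E3 →L[ℝ] ℝ).toLinearMap +
    Real.sin (Real.pi * (j.val + 1 / 2) / n) •
      (EuclideanSpace.proj (1 : Fin 3) : E3 →L[ℝ] ℝ).toLinearMap

theorem height_point (j k : ZMod (2 * n)) :
    height j (point k).1 = Real.cos (Real.pi / n * (k.val - j.val - 1 / 2)) := by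
  have h : height j (point k).1 = Real.cos (Real.pi * (j.val + 1 / 2) / n) * (point k).1 0 +
    Real.sin (Real.pi * (j.val + 1 / 2) / n) * (point k).1 1 := rfl
  have hn : (n : ℝ) ≠ 0 := Nat.cast_ne_zero.2 (NeZero.ne n)
  rw [h, point_zero, point_one, ← Real.cos_sub, ← Real.cos_neg]
  congr 1
  push_cast
  field_simp
  ring

theorem val_add_one_cases (j : ZMod (2 * n)) :
    ((j + 1).val = j.val + 1) ∨ (j.val + 1 = 2 * n ∧ (j + 1).val = 0) := by
  have hn : 0 < n := Nat.pos_of_neZero n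
  have : Fact (1 < 2 * n) := ⟨by omega⟩
  have hj := ZMod.val_lt j
  rw [ZMod.val_add, ZMod.val_one]
  rcases Nat.lt_or_ge (j.val + 1) (2 * n) with h | h
  · exact Or.inl (Nat.mod_eq_of_lt h)
  · have h' : j.val + 1 = 2 * n := by omega
    exact Or.inr ⟨h', by rw [h', Nat.mod_self]⟩

theorem height_point_self (j : ZMod (2 * n)) :
    height j (point j).1 = Real.cos (Real.pi / (2 * n)) := by
  rw [height_point, ← Real.cos_neg]
  congr 1
  field_simp
  ring

theorem height_point_succ (j : ZMod (2 * n)) :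
    height j (point (j + 1)).1 = Real.cos (Real.pi / (2 * n)) := by
  have hn : (n : ℝ) ≠ 0 := Nat.cast_ne_zero.2 (NeZero.ne n)
  rw [height_point]
  rcases val_add_one_cases j with h | ⟨h, h'⟩
  · rw [h]
    congr 1
    push_cast
    field_simp
    ring
  -- Wrap-around from the last point to `point 0`: the angle changes by a full turn.
  · have : (j.val : ℝ) = 2 * n - 1 := by
      rw [eq_sub_iff_add_eq]; exact_mod_cast h
    rw [h', this, ← Real.cos_add_two_pi]
    congr 1
    push_cast
    field_simp
    ring

theorem cos_lt_cos_of_lt_abs {a b : ℝ} (ha : 0 ≤ a) (h1 : a < |b|) (h2 : |b| < 2 * Real.pi - a) :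
    Real.cos b < Real.cos a := by
  rw [← Real.cos_abs b]
  rcases le_total |b| Real.pi with h | h
  · exact Real.cos_lt_cos_of_nonneg_of_le_pi ha h h1
  · rw [← Real.cos_two_pi_sub |b|]
    exact Real.cos_lt_cos_of_nonneg_of_le_pi ha (by linarith) (by linarith)

theorem height_point_lt {j k : ZMod (2 * n)} (h : k ≠ j) (h' : k ≠ j + 1) :
    height j (point k).1 < Real.cos (Real.pi / (2 * n)) := by
  have hn : 0 < n := Nat.pos_of_neZero n
  have hn' : (0 : ℝ) < n := Nat.cast_pos.2 hn
  have hj := ZMod.val_lt j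
  have hj' := ZMod.val_lt (j + 1)
  have hk := ZMod.val_lt k
  have e1 : k.val ≠ j.val := fun e => h (ZMod.val_injective _ e)
  have e2 : k.val ≠ (j + 1).val := fun e => h' (ZMod.val_injective _ e)
  -- In units of `π / n`, the endpoints of the chord are at angle `1 / 2` from its midpoint
  -- direction, and every other point is at least `3 / 2` away, in both directions around the
  -- circle.
  have key : (3 / 2 : ℝ) ≤ |(k.val : ℝ) - j.val - 1 / 2| ∧
      |(k.val : ℝ) - j.val - 1 / 2| ≤ 2 * n - 3 / 2 := by
    rcases Nat.lt_or_ge j.val k.val with hlt | hge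
    · have a1 : j.val + 2 ≤ k.val := by rcases val_add_one_cases j with h | h <;> omega
      have a2 : k.val + 1 ≤ 2 * n + j.val := by omega
      have a1' : (j.val : ℝ) + 2 ≤ k.val := by exact_mod_cast a1
      have a2' : (k.val : ℝ) + 1 ≤ 2 * n + j.val := by exact_mod_cast a2
      rw [abs_of_nonneg (by linarith)]
      constructor <;> linarith
    · have a1 : k.val + 1 ≤ j.val := by omega
      have a2 : j.val + 2 ≤ 2 * n + k.val := by rcases val_add_one_cases j with h | h <;> omega
      have a1' : (k.val : ℝ) + 1 ≤ j.val := by exact_mod_cast a1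
      have a2' : (j.val : ℝ) + 2 ≤ 2 * n + k.val := by exact_mod_cast a2
      rw [abs_of_nonpos (by linarith)]
      constructor <;> linarith
  have hθ : 0 < Real.pi / n := div_pos Real.pi_pos hn'
  have e3 : Real.pi / (2 * n) = Real.pi / n * (1 / 2) := by field_simp
  have e4 : 2 * Real.pi = Real.pi / n * (2 * n) := by field_simp
  rw [height_point]
  apply cos_lt_cos_of_lt_abs (by positivity)
  · rw [abs_mul, abs_of_pos hθ, e3]
    exact mul_lt_mul_of_pos_left (by linarith) hθ
  · rw [abs_mul, abs_of_pos hθ, e3, e4, ← mul_sub]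
    exact mul_lt_mul_of_pos_left (by linarith) hθ

/-- The chords of the internal tangle are pairwise disjoint. -/
theorem eq_of_mem_segment {j k : ZMod (2 * n)} (hj : Odd j.val) (hk : Odd k.val) {x : E3}
    (hxj : x ∈ segment ℝ (point j).1 (point (j + 1)).1)
    (hxk : x ∈ segment ℝ (point k).1 (point (k + 1)).1) : j = k := by
  by_contra hjk
  have h1 : k ≠ j + 1 := by
    rintro rfl
    exact (odd_val_add_one j).1 hk hj
  have h2 : k + 1 ≠ j := by
    rintro rfl
    exact (odd_val_add_one k).1 hj hk
  have h3 : k + 1 ≠ j + 1 := fun e => hjk (add_right_cancel e).symm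
  -- By parity the chords share no endpoint, so a level line of `height j` separates them.
  have hle : Real.cos (Real.pi / (2 * n)) ≤ height j x := by
    have hc : Convex ℝ {y | Real.cos (Real.pi / (2 * n)) ≤ height j y} :=
      convex_halfSpace_ge (height j).isLinear _
    exact hc.segment_subset (height_point_self j).ge (height_point_succ j).ge hxj
  have hlt : height j x < Real.cos (Real.pi / (2 * n)) := by
    have hc : Convex ℝ {y | height j y < Real.cos (Real.pi / (2 * n))} :=
      convex_halfSpace_lt (height j).isLinear _
    exact hc.segment_subset (height_point_lt (Ne.symm hjk) h1) (height_point_lt h2 h3) hxk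
  exact absurd hle (not_le.2 hlt)

/-- Strict convexity of the ball. Thus chords meet the gluing sphere only at their endpoints. -/
theorem eq_or_eq_of_mem_segment {x y z : S2} (h : x.1 ∈ segment ℝ y.1 z.1) : x = y ∨ x = z := by
  by_contra! hne
  have hy : y.1 ∈ Metric.closedBall (0 : E3) 1 := Metric.sphere_subset_closedBall y.2
  have hz : z.1 ∈ Metric.closedBall (0 : E3) 1 := Metric.sphere_subset_closedBall z.2
  have hx : x.1 ∈ openSegment ℝ y.1 z.1 :=
    mem_openSegment_of_ne_left_right (fun e => hne.1 (Subtype.ext e.symm))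
      (fun e => hne.2 (Subtype.ext e.symm)) h
  have hyz : y.1 ≠ z.1 := by
    intro e
    rw [e, openSegment_same] at hx
    exact hne.2 (Subtype.ext hx)
  have := openSegment_subset_ball_of_ne hy hz hyz hx
  rw [mem_ball_zero_iff] at this
  have hx1 := mem_sphere_zero_iff_norm.1 x.2
  linarith

theorem segment_subset_closedBall (x y : S2) :
    segment ℝ x.1 y.1 ⊆ Metric.closedBall (0 : E3) 1 :=
  (convex_closedBall _ _).segment_subset (Metric.sphere_subset_closedBall x.2)
    (Metric.sphere_subset_closedBall y.2)

end Points

variable {n : ℕ} [NeZero n]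

/-! ### Connectedness along the arcs. -/

section Arcs

variable (β : SphericalBraid (2 * n))

theorem continuous_ofM : Continuous ofM := continuous_quot_mk.comp continuous_inl

theorem continuous_ofStrip : Continuous ofStrip :=
  continuous_quot_mk.comp (continuous_inr.comp continuous_inl)

theorem continuous_ofBall : Continuous ofBall :=
  continuous_quot_mk.comp (continuous_inr.comp continuous_inr)

theorem continuous_cylPoint : Continuous cylPoint := continuous_quot_mk.comp continuous_inl

theorem ofM_cylPoint_zero (x : S2) : ofM (cylPoint (x, 0)) = ofStrip (x, 0) :=
  Quot.sound (GlueRel.outer x)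

theorem ofStrip_one (x : S2) : ofStrip (x, 1) = ofBall (sphereToBall x) :=
  Quot.sound (GlueRel.inner x)

theorem cylPoint_one (x : S2) : cylPoint (x, 1) = Quot.mk _ (Sum.inr (cover x)) :=
  Quot.sound (CylinderRel.glue x)

theorem ofM_cylPoint_mem (i : ZMod (2 * n)) (t : I) :
    ofM (cylPoint (point i, t)) ∈ platClosure β :=
  Or.inl (Or.inl ⟨_, ⟨i, t, rfl⟩, rfl⟩)

theorem ofStrip_mem (i : ZMod (2 * n)) (t : I) :
    ofStrip (β.F t (point i), t) ∈ platClosure β :=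
  Or.inl (Or.inr ⟨_, ⟨(point i, t), ⟨⟨i, rfl⟩, trivial⟩, rfl⟩, rfl⟩)

theorem ofBall_mem {j : ZMod (2 * n)} (hj : Odd j.val) {x : Ball3}
    (hx : x.1 ∈ segment ℝ (point j).1 (point (j + 1)).1) : ofBall x ∈ platClosure β :=
  Or.inr ⟨_, ⟨j, hj, hx⟩, rfl⟩

/-- The component of the closure that contains the string starting at `point i`. -/
def component (i : ZMod (2 * n)) : ConnectedComponents (platClosure β) :=
  ConnectedComponents.mk ⟨ofStrip (β.F 0 (point i), 0), ofStrip_mem β i 0⟩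

variable {β}

theorem mk_eq_mk_of_continuous {X Y : Type*} [TopologicalSpace X] [PreconnectedSpace X]
    [TopologicalSpace Y] {L : Set Y} {γ : X → Y} (hγ : Continuous γ) (h : ∀ t, γ t ∈ L) (s t : X) :
    (ConnectedComponents.mk ⟨γ s, h s⟩ : ConnectedComponents L) =
      ConnectedComponents.mk ⟨γ t, h t⟩ := by
  have hc : Continuous fun t => (⟨γ t, h t⟩ : L) := hγ.subtype_mk h
  rw [ConnectedComponents.coe_eq_coe']
  exact (isPreconnected_range hc).subset_connectedComponent ⟨t, rfl⟩ ⟨s, rfl⟩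

theorem mk_ofStrip (i : ZMod (2 * n)) (t : I) :
    ConnectedComponents.mk ⟨ofStrip (β.F t (point i), t), ofStrip_mem β i t⟩ = component β i :=
  mk_eq_mk_of_continuous (γ := fun t => ofStrip (β.F t (point i), t))
    (continuous_ofStrip.comp ((β.continuous_F.comp (Continuous.prodMk_right _)).prodMk
      continuous_id)) (ofStrip_mem β i) t 0

theorem mk_ofM (i : ZMod (2 * n)) (t : I) :
    ConnectedComponents.mk ⟨ofM (cylPoint (point i, t)), ofM_cylPoint_mem β i t⟩ =
      component β i := by
  rw [mk_eq_mk_of_continuous (γ := fun t => ofM (cylPoint (point i, t)))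
    (continuous_ofM.comp (continuous_cylPoint.comp (Continuous.prodMk_right _)))
    (ofM_cylPoint_mem β i) t 0, component]
  congr 2
  rw [ofM_cylPoint_zero, β.F_zero]

/-- The two halves of a residual arc meet over `RP2`, at the end `t = 1` of the mapping cylinder. -/
theorem component_add_half (i : ZMod (2 * n)) : component β (i + n) = component β i := by
  rw [← mk_ofM i 1, ← mk_ofM (i + (n : ZMod (2 * n))) 1]
  congr 3
  rw [cylPoint_one, cylPoint_one, cover_point_eq_iff.2 (Or.inr rfl)]

theorem point_mem_segment (j : ZMod (2 * n)) :
    (sphereToBall (point j)).1 ∈ segment ℝ (point j).1 (point (j + 1)).1 :=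
  left_mem_segment ℝ _ _

theorem point_succ_mem_segment (j : ZMod (2 * n)) :
    (sphereToBall (point (j + 1))).1 ∈ segment ℝ (point j).1 (point (j + 1)).1 :=
  right_mem_segment ℝ _ _

theorem mk_ofBall_eq_mk_ofBall {j : ZMod (2 * n)} (hj : Odd j.val) {x y : Ball3}
    (hx : x.1 ∈ segment ℝ (point j).1 (point (j + 1)).1)
    (hy : y.1 ∈ segment ℝ (point j).1 (point (j + 1)).1) :
    (ConnectedComponents.mk ⟨ofBall x, ofBall_mem β hj hx⟩ :
        ConnectedComponents (platClosure β)) =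
      ConnectedComponents.mk ⟨ofBall y, ofBall_mem β hj hy⟩ := by
  have : PreconnectedSpace (segment ℝ (point j).1 (point (j + 1)).1) :=
    Subtype.preconnectedSpace (convex_segment _ _).isPreconnected
  exact mk_eq_mk_of_continuous
    (γ := fun z : segment ℝ (point j).1 (point (j + 1)).1 =>
      ofBall ⟨z.1, segment_subset_closedBall _ _ z.2⟩)
    (continuous_ofBall.comp (continuous_subtype_val.subtype_mk _))
    (fun z => ofBall_mem β hj z.2) ⟨x.1, hx⟩ ⟨y.1, hy⟩

theorem mk_ofBall_sphereToBall (i : ZMod (2 * n))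
    (h : ofBall (sphereToBall (point (β.perm i))) ∈ platClosure β) :
    ConnectedComponents.mk ⟨ofBall (sphereToBall (point (β.perm i))), h⟩ = component β i := by
  rw [← mk_ofStrip i 1]
  congr 2
  rw [β.point_perm, ofStrip_one]

theorem mk_ofBall {i : ZMod (2 * n)} (hi : Odd (β.perm i).val) {x : Ball3}
    (hx : x.1 ∈ segment ℝ (point (β.perm i)).1 (point (β.perm i + 1)).1) :
    ConnectedComponents.mk ⟨ofBall x, ofBall_mem β hi hx⟩ = component β i := by
  rw [← mk_ofBall_sphereToBall i (ofBall_mem β hi (point_mem_segment _))]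
  exact mk_ofBall_eq_mk_ofBall hi hx (point_mem_segment _)

theorem g_of_odd {j : ZMod (2 * n)} (hj : Odd j.val) : g n j = j + 1 := if_pos hj

theorem odd_g_of_not_odd {j : ZMod (2 * n)} (hj : ¬ Odd j.val) : Odd (g n j).val := by
  have h : g n j = j - 1 := if_neg hj
  have h' := odd_val_add_one (j - 1)
  rw [sub_add_cancel] at h'
  rw [h]
  tauto

/-- A chord joins the ends of strings `i` and `τ i`. As `τ` is an involution, it suffices to treat
the string ending at an odd point. -/
theorem component_tau (i : ZMod (2 * n)) : component β (tau β i) = component β i := by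
  have odd_case (i : ZMod (2 * n)) (hi : Odd (β.perm i).val) :
      component β (tau β i) = component β i := by
    have h : β.perm (tau β i) = β.perm i + 1 := by rw [perm_tau, g_of_odd hi]
    have hs : (sphereToBall (point (β.perm (tau β i)))).1 ∈
        segment ℝ (point (β.perm i)).1 (point (β.perm i + 1)).1 := by
      rw [h]
      exact point_succ_mem_segment _
    rw [← mk_ofBall_sphereToBall (tau β i) (ofBall_mem β hi hs), mk_ofBall hi hs]
  by_cases hi : Odd (β.perm i).val
  · exact odd_case i hi
  · have := odd_case (tau β i) (by rw [perm_tau]; exact odd_g_of_not_odd hi)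
    rw [tau_involutive] at this
    exact this.symm

theorem component_surjective : Function.Surjective (component β) := by
  intro c
  obtain ⟨⟨x, hx⟩, rfl⟩ := ConnectedComponents.surjective_coe c
  have hx' := hx
  rcases hx' with (⟨y, ⟨i, t, rfl⟩, rfl⟩ | ⟨y, ⟨⟨_, t⟩, ⟨⟨i, rfl⟩, -⟩, rfl⟩, rfl⟩) |
    ⟨y, ⟨j, hj, hy⟩, rfl⟩
  · exact ⟨i, (mk_ofM i t).symm⟩
  · exact ⟨i, (mk_ofStrip i t).symm⟩
  · obtain ⟨i, rfl⟩ := β.perm.surjective j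
    exact ⟨i, (mk_ofBall hj hy).symm⟩

end Arcs

/-! ### Separation by disjoint closed sets. -/

section Separation

variable (β : SphericalBraid (2 * n)) (S : Set (ZMod (2 * n)))

/-- The set of indices is a union of index sets of closed strings. -/
def IsSaturated : Prop := ∀ i ∈ S, i + n ∈ S ∧ tau β i ∈ S

/-- The parts of the closure lying in the strip that belong to strings with index in `S`. -/
def subStrings : Set (S2 × I) := {q | ∃ i ∈ S, q.1 = β.F q.2 (point i)}

/-- The arcs of the internal tangle that belong to strings with index in `S`. -/
def subInternal : Set Ball3 :=
  {x | ∃ i ∈ S, Odd (β.perm i).val ∧ x.1 ∈ segment ℝ (point (β.perm i)).1 (point (β.perm i + 1)).1}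

/-- The part of the cylinder and of its base lying over the special points with index in `S`. -/
def subCylinder : Set ((S2 × I) ⊕ RP2) :=
  Sum.elim {q | ∃ i ∈ S, q.1 = point i} {y | ∃ i ∈ S, y = cover (point i)}

variable {β S}

theorem IsSaturated.cylinder_iff (hS : IsSaturated β S) {a b : (S2 × I) ⊕ RP2}
    (h : CylinderRel cover a b) : subCylinder S a ↔ subCylinder S b := by
  obtain ⟨x⟩ := h
  constructor
  · rintro ⟨i, hi, h⟩
    exact ⟨i, hi, congrArg cover h⟩
  · rintro ⟨i, hi, h⟩
    rcases cover_point_eq_iff.1 h with h | h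
    · exact ⟨i, hi, h⟩
    · exact ⟨_, (hS i hi).1, h⟩

/-- The arcs of the residual tangle with index in `S`. -/
def IsSaturated.subResidual (hS : IsSaturated β S) : Set M :=
  Quot.lift (subCylinder S) fun _ _ h => propext (hS.cylinder_iff h)

/-- Lets the pieces descend to the quotient `RP3`. At the outer sphere `F 0` is the identity; at the
inner one, stability under `τ` keeps both ends of each chord in `S`. -/
theorem IsSaturated.glue_iff (hS : IsSaturated β S) {a b : M ⊕ (S2 × I) ⊕ Ball3}
    (h : GlueRel a b) :
    Sum.elim hS.subResidual (Sum.elim (subStrings β S) (subInternal β S)) a ↔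
      Sum.elim hS.subResidual (Sum.elim (subStrings β S) (subInternal β S)) b := by
  rcases h with x | x
  · change (∃ i ∈ S, x = point i) ↔ ∃ i ∈ S, x = β.F 0 (point i)
    simp only [β.F_zero]
  · change (∃ i ∈ S, x = β.F 1 (point i)) ↔ ∃ i ∈ S, Odd (β.perm i).val ∧
      x.1 ∈ segment ℝ (point (β.perm i)).1 (point (β.perm i + 1)).1
    simp only [← β.point_perm]
    constructor
    · rintro ⟨i, hi, rfl⟩
      by_cases ho : Odd (β.perm i).val
      · exact ⟨i, hi, ho, point_mem_segment _⟩
      · have ho' := odd_g_of_not_odd ho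
        refine ⟨_, (hS i hi).2, by rwa [perm_tau], ?_⟩
        rw [perm_tau, ← g_of_odd ho', g_involutive]
        exact right_mem_segment ℝ _ _
    · rintro ⟨i, hi, ho, hx⟩
      rcases eq_or_eq_of_mem_segment hx with rfl | rfl
      · exact ⟨i, hi, rfl⟩
      · exact ⟨_, (hS i hi).2, by rw [perm_tau, g_of_odd ho]⟩

/-- The part of the closure made of the arcs with index in `S`. -/
def IsSaturated.subClosure (hS : IsSaturated β S) : Set RP3 :=
  Quot.lift (Sum.elim hS.subResidual (Sum.elim (subStrings β S) (subInternal β S)))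
    fun _ _ h => propext (hS.glue_iff h)

theorem isClosed_subCylinder : IsClosed (subCylinder S) := by
  have hS : S.Finite := S.toFinite
  rw [isClosed_sum_iff]
  constructor
  · have : Sum.inl ⁻¹' subCylinder S = ⋃ i ∈ S, {q : S2 × I | q.1 = point i} := by
      ext q
      simp only [Set.mem_iUnion, exists_prop]
      rfl
    rw [this]
    exact hS.isClosed_biUnion fun i _ => isClosed_eq continuous_fst continuous_const
  · have : IsClosed (cover ⁻¹' (Sum.inr ⁻¹' subCylinder S)) := by
      have : cover ⁻¹' (Sum.inr ⁻¹' subCylinder S) = ⋃ i ∈ S, {point i, point (i + (n : ZMod (2 * n)))} := by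
        ext x
        simp only [Set.mem_iUnion, exists_prop, Set.mem_insert_iff, Set.mem_singleton_iff,
          ← cover_point_eq_iff]
        rfl
      rw [this]
      exact hS.isClosed_biUnion fun i _ => (Set.toFinite _).isClosed
    -- Closedness is tested upstairs on the sphere, where the set is finite; no separation property
    -- of the quotient is needed.
    exact isQuotientMap_quotient_mk'.isClosed_preimage.1 this

theorem isClosed_subStrings : IsClosed (subStrings β S) := by
  have : subStrings β S = ⋃ i ∈ S, {q : S2 × I | q.1 = β.F q.2 (point i)} := by
    ext q
    simp only [Set.mem_iUnion, exists_prop]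
    rfl
  rw [this]
  refine S.toFinite.isClosed_biUnion fun i _ => isClosed_eq continuous_fst ?_
  exact β.continuous_F.comp (continuous_const.prodMk continuous_snd)

theorem isClosed_subInternal : IsClosed (subInternal β S) := by
  have : subInternal β S = ⋃ i ∈ S ∩ {i | Odd (β.perm i).val},
      Subtype.val ⁻¹' segment ℝ (point (β.perm i)).1 (point (β.perm i + 1)).1 := by
    ext q
    simp only [Set.mem_iUnion, exists_prop, Set.mem_inter_iff, and_assoc]
    rfl
  rw [this]
  refine (Set.toFinite _).isClosed_biUnion fun i _ => ?_
  rw [← convexHull_pair]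
  exact ((Set.toFinite _).isClosed_convexHull ℝ).preimage continuous_subtype_val

theorem IsSaturated.isClosed_subClosure (hS : IsSaturated β S) : IsClosed hS.subClosure := by
  have h : IsClosed hS.subResidual :=
    isQuotientMap_quot_mk.isClosed_preimage.1 (isClosed_subCylinder (S := S))
  refine isQuotientMap_quot_mk.isClosed_preimage.1 ?_
  rw [isClosed_sum_iff, isClosed_sum_iff]
  exact ⟨h, isClosed_subStrings, isClosed_subInternal⟩

theorem IsSaturated.disjoint_subClosure {T : Set (ZMod (2 * n))} (hS : IsSaturated β S)
    (hT : IsSaturated β T) (h : Disjoint S T) : Disjoint hS.subClosure hT.subClosure := by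
  have hne {i j : ZMod (2 * n)} (hi : i ∈ S) (hj : j ∈ T) : i ≠ j := h.ne_of_mem hi hj
  rw [Set.disjoint_left]
  rintro ⟨m | q | x⟩
  · obtain ⟨q | y⟩ := m
    · rintro ⟨i, hi, h1⟩ ⟨j, hj, h2⟩
      exact hne hi hj (point_injective (h1.symm.trans h2))
    · rintro ⟨i, hi, h1⟩ ⟨j, hj, h2⟩
      rcases cover_point_eq_iff.1 (h1.symm.trans h2) with h3 | h3
      · exact hne hi hj (point_injective h3)
      -- Over `RP2` an index is determined only up to adding `n`, so stability of `T` is needed.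
      · exact hne hi (hT j hj).1 (point_injective h3)
  · rintro ⟨i, hi, h1⟩ ⟨j, hj, h2⟩
    exact hne hi hj (point_injective ((β.F q.2).injective (h1.symm.trans h2)))
  · rintro ⟨i, hi, oi, h1⟩ ⟨j, hj, oj, h2⟩
    exact hne hi hj (β.perm.injective (eq_of_mem_segment oi oj h1 h2))

theorem IsSaturated.exists_of_mem_platClosure {x : RP3} (hx : x ∈ platClosure β) :
    ∃ i, ∀ (S : Set (ZMod (2 * n))) (hS : IsSaturated β S), i ∈ S → x ∈ hS.subClosure := by
  rcases hx with (⟨y, ⟨i, t, rfl⟩, rfl⟩ | ⟨y, ⟨⟨_, t⟩, ⟨⟨i, rfl⟩, -⟩, rfl⟩, rfl⟩) |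
    ⟨y, ⟨j, hj, hy⟩, rfl⟩
  · exact ⟨i, fun S hS hi => ⟨i, hi, rfl⟩⟩
  · exact ⟨i, fun S hS hi => ⟨i, hi, rfl⟩⟩
  · obtain ⟨i, rfl⟩ := β.perm.surjective j
    exact ⟨i, fun S hS hi => ⟨i, hi, hj, hy⟩⟩

/-- Strings in the same component of the closure cannot be separated by a saturated set. -/
theorem IsSaturated.mem_of_component_eq (hS : IsSaturated β S) (hS' : IsSaturated β Sᶜ)
    {i j : ZMod (2 * n)} (hij : component β i = component β j) (hi : i ∈ S) : j ∈ S := by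
  have hdisj := hS.disjoint_subClosure hS' disjoint_compl_right
  -- The index `k` of `x` does not depend on the saturated set, so it serves for `S` and `Sᶜ` alike.
  have hcover (x : platClosure β) : x.1 ∈ hS.subClosure ∨ x.1 ∈ hS'.subClosure := by
    obtain ⟨k, hk⟩ := exists_of_mem_platClosure x.2
    exact (em (k ∈ S)).imp (hk S hS) (hk Sᶜ hS')
  have hcompl : (Subtype.val ⁻¹' hS.subClosure : Set (platClosure β))ᶜ =
      Subtype.val ⁻¹' hS'.subClosure := by
    ext x
    exact ⟨(hcover x).resolve_left, fun h h' => Set.disjoint_left.1 hdisj h' h⟩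
  have hclopen : IsClopen (Subtype.val ⁻¹' hS.subClosure : Set (platClosure β)) := by
    refine ⟨hS.isClosed_subClosure.preimage continuous_subtype_val, ?_⟩
    rw [← isClosed_compl_iff, hcompl]
    exact hS'.isClosed_subClosure.preimage continuous_subtype_val
  have hcc : (⟨ofStrip (β.F 0 (point j), 0), ofStrip_mem β j 0⟩ : platClosure β) ∈
      connectedComponent ⟨ofStrip (β.F 0 (point i), 0), ofStrip_mem β i 0⟩ :=
    ConnectedComponents.coe_eq_coe'.1 hij.symm
  have hstart : ofStrip (β.F 0 (point i), 0) ∈ hS.subClosure := ⟨i, hi, rfl⟩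
  have hmem : ofStrip (β.F 0 (point j), 0) ∈ hS.subClosure :=
    hclopen.connectedComponent_subset hstart hcc
  by_contra hj
  exact Set.disjoint_left.1 hdisj hmem ⟨j, hj, rfl⟩

end Separation

/-! ### Matching components with cycles. -/

theorem IsResidualPerm.numComponents_eq {β : SphericalBraid (2 * n)}
    {h : Equiv.Perm (Coset n)} (hh : IsResidualPerm β h) :
    numComponents (platClosure β) = numCycles h := by
  have hsat (S : Set (Quotient (Equiv.Perm.SameCycle.setoid h))) :
      IsSaturated β {i | Quotient.mk _ (QuotientAddGroup.mk i : Coset n) ∈ S} := by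
    intro i hi
    refine ⟨?_, ?_⟩
    · rw [Set.mem_ofPred_eq, coset_mk_add]
      exact hi
    · rw [Set.mem_ofPred_eq, Quotient.sound (hh.sameCycle_tau i)]
      exact hi
  have hiff (i j : ZMod (2 * n)) : component β i = component β j ↔
      h.SameCycle (QuotientAddGroup.mk i) (QuotientAddGroup.mk j) := by
    refine ⟨fun e => ?_, hh.eq_of_sameCycle component_add_half component_tau⟩
    -- Separate by the indices whose coset lies in the cycle of `i`.
    have := (hsat {Quotient.mk _ (QuotientAddGroup.mk i)}).mem_of_component_eq
      (hsat {Quotient.mk _ (QuotientAddGroup.mk i)}ᶜ) e rfl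
    exact (Quotient.exact this).symm
  let φ : ZMod (2 * n) → Quotient (Equiv.Perm.SameCycle.setoid h) :=
    fun i => Quotient.mk _ (QuotientAddGroup.mk i)
  have hφ : Function.Surjective φ :=
    Quotient.mk_surjective.comp QuotientAddGroup.mk_surjective
  refine (Nat.card_congr (Equiv.ofBijective
    (fun q => component β (Function.surjInv hφ q)) ⟨fun p q e => ?_, fun c => ?_⟩)).symm
  · rw [← Function.surjInv_eq hφ p, ← Function.surjInv_eq hφ q]
    exact Quotient.sound ((hiff _ _).1 e)
  · obtain ⟨i, rfl⟩ := component_surjective c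
    exact ⟨φ i, (hiff _ _).2 (Quotient.exact (Function.surjInv_eq hφ (φ i)))⟩

end ProjectivePlat

end

theorem theorem5p1 (n : ℕ) [NeZero n] (β : ProjectivePlat.SphericalBraid (2 * n)) :
    (∃ h : Equiv.Perm (ProjectivePlat.Coset n), ProjectivePlat.IsResidualPerm β h) ∧
    ∀ h : Equiv.Perm (ProjectivePlat.Coset n), ProjectivePlat.IsResidualPerm β h →
      ProjectivePlat.numComponents (ProjectivePlat.platClosure β) =
        ProjectivePlat.numCycles h :=
  ⟨ProjectivePlat.exists_isResidualPerm β, fun _ hh => hh.numComponents_eq⟩
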